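/- Let $\mathbb I=[0,1]\setminus\mathbb Q$, let $G:\mathbb I\to\mathbb I$, $G(x)=\{1/x\}$, be the Gauss map and $a(x)=\lfloor 1/x\rfloor$ the partial quotient function. For $n\ge 1$ let $\alpha_n$ be the partition of $\mathbb I$ into the cylinders $\{x: a(G^kx)=a_k \text{ for all } 0\le k<n\}$, $(a_0,\dots,a_{n-1})\in\mathbb N^n$. A Borel probability measure $\mu$ on $\mathbb I$ is called a weak Renyi measure for $G$ if it is $G$-invariant and there is a constant $C>1$ such that $\mu(A\cap G^{-n}B)\le C\,\mu(A)\mu(B)$ for all $n\ge 1$, all $A\in\sigma(\alpha_n)$ and all Borel sets $B\subseteq\mathbb I$. Write $\mathbb E_\mu(\log a):=2\int_{\mathbb I}\log\frac1x\,d\mu(x)\in[0,\infty]$. **Theorem 3.2 (Generalized Khinchine Theorem).** Let $\mu$ be a weak Renyi measure for $G$, and let $f:\{1,2,\dots\}\to[0,\infty)$ be such that the sequence $n f(n)$ is non-increasing and tends to $0$. (i) If $\sum_{n\ge 1}\frac{\mu((0,nf(n)))}{n}<\infty$, then for $\mu$-almost every $x\in\mathbb I$ the set of rational numbers $\frac pq$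 ($p\in\mathbb Z$, $q\ge 1$) with $\left|x-\frac pq\right|<\frac{f(q)}{Mq}$ is finite, where $M=2e^8$. (ii) If $\mu$ is ergodic for $G$, $\mathbb E_\mu(\log a)<\infty$ and $\sum_{n\ge 1}\frac{\mu((0,nf(n)))}{n}=\infty$, then for $\mu$-almost every $x\in\mathbb I$ the set of rational numbers $\frac pq$ ($p\in\mathbb Z$, $q\ge 1$) with $\left|x-\frac pq\right|<\frac{f(q)}{q}$ is infinite. -/

import Mathlib

open MeasureTheory Set Filter
open scoped ENNReal Topology

namespace GaussMap

/-- The space `𝕀 = [0,1] \ ℚ` of irrational numbers of the unit interval, as a subtype of `ℝ`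
(it carries the Borel σ-algebra induced from `ℝ`). -/
abbrev UnitIrrational : Type := {x : ℝ // x ∈ Icc (0 : ℝ) 1 ∧ Irrational x}

/-- The fractional part of `1 / x` is again an irrational number of the unit interval. -/
theorem fract_one_div_mem (x : UnitIrrational) :
    Int.fract (1 / (x : ℝ)) ∈ Icc (0 : ℝ) 1 ∧ Irrational (Int.fract (1 / (x : ℝ))) := by
  refine ⟨⟨Int.fract_nonneg _, (Int.fract_lt_one _).le⟩, ?_⟩
  have h : Irrational (1 / (x : ℝ)) := by
    rw [one_div]
    exact x.2.2.inv
  rw [Int.fract]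
  exact h.sub_intCast _

/-- The Gauss map `G(x) = {1/x} = 1/x - [1/x]` of `𝕀` to itself. -/
noncomputable def gauss (x : UnitIrrational) : UnitIrrational :=
  ⟨Int.fract (1 / (x : ℝ)), fract_one_div_mem x⟩

/-- The partial quotient function `a(x) = [1/x]`. -/
noncomputable def partialQuotient (x : UnitIrrational) : ℕ := ⌊1 / (x : ℝ)⌋₊

/-- The partition `α_n` of `𝕀` into the sets `[a ∘ G^k = a_k for all 0 ≤ k < n]`,
`(a_0, …, a_{n-1})` a sequence of natural numbers. (A sequence that is not realized only
contributes the empty set.) -/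
def cylinders (n : ℕ) : Set (Set UnitIrrational) :=
  range fun s : Fin n → ℕ =>
    {x : UnitIrrational | ∀ k : Fin n, partialQuotient (gauss^[(k : ℕ)] x) = s k}

/-- A weak Renyi measure for the Gauss map: `μ` is `G`-invariant and, for some `M > 1`,
`μ(A ∩ G⁻ⁿ B) ≤ M μ(A) μ(B)` for all `n ≥ 1`, all `A ∈ σ(α_n)` and all Borel sets `B`. It is
used for probability measures `μ`. -/
structure IsWeakRenyi (μ : Measure UnitIrrational) : Prop where
  invariant : MeasurePreserving gauss μ μ
  bound : ∃ M : ℝ, 1 < M ∧ ∀ n : ℕ, 1 ≤ n → ∀ A B : Set UnitIrrational,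
    MeasurableSet[MeasurableSpace.generateFrom (cylinders n)] A → MeasurableSet B →
      μ (A ∩ gauss^[n] ⁻¹' B) ≤ ENNReal.ofReal M * μ A * μ B

/-- `E_μ(log a) := 2 ∫ log (1/x) dμ(x)`, with values in `[0, ∞]`. -/
noncomputable def expLog (μ : Measure UnitIrrational) : ℝ≥0∞ :=
  2 * ∫⁻ x : UnitIrrational, ENNReal.ofReal (Real.log (1 / (x : ℝ))) ∂μ

/-- The series `∑_{n ≥ 1} μ((0, n f(n))) / n`, with values in `[0, ∞]`; the index `n` of the
series is `k + 1` here. -/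
noncomputable def khinchineSum (μ : Measure UnitIrrational) (f : ℕ → ℝ) : ℝ≥0∞ :=
  ∑' k : ℕ, μ {x : UnitIrrational | (x : ℝ) ∈ Ioo (0 : ℝ) (((k + 1 : ℕ) : ℝ) * f (k + 1))} /
    ((k + 1 : ℕ) : ℝ≥0∞)

/-- The set of rational numbers `p/q` (`p ∈ ℤ`, `q ≥ 1`) with `|x - p/q| < g(q)`. -/
def solutions (x : ℝ) (g : ℕ → ℝ) : Set ℚ :=
  {r : ℚ | ∃ (p : ℤ) (q : ℕ), 1 ≤ q ∧ r = (p : ℚ) / (q : ℚ) ∧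
    |x - (p : ℝ) / (q : ℝ)| < g q}

end GaussMap

namespace GaussMap

/-! ### Convergents -/

/-! Let `p_n / q_n` be the convergents of `x`, with `0 / 1` at index `0`. The error `|x - p_n/q_n|`
lies between `G^n x / (2 q_n^2)` and `G^n x / q_n^2`, so up to a factor `2` a convergent is a
solution exactly when `G^n x < q_n f(q_n)`. The theorem thus becomes a Borel–Cantelli problem for
visits of the orbit to shrinking intervals at `0`.

Convergence: by Legendre's theorem all but finitely many solutions are convergents. As `q_n ≥
2^(n/2)` and `n f(n)` is non-increasing, the target at time `n` lies in a deterministic interval.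
Invariance, condensation along powers of `2` and the first Borel–Cantelli lemma finish
(`ae_eventually_mul_le`).

Divergence: the times `r i` are compared with the scale `L^i`. Markov's inequality applied to `log
q_n ≤ ∑ log (1 / G^k x)` shows that `q_(ri) > L^i` is rare uniformly in `i`; this event is a union
of cylinders, so the Renyi bound keeps at least half of each target (`exists_le_measureReal_inter`).
Ergodicity makes cylinders exponentially small, and an interval at `0` is a union of cylinders up to
a single one; hence the Renyi bound gives quasi-independence with a summable error
(`measureReal_inter_preimage_below_le`). A second moment argument then gives positive measure, and
ergodicity upgrades it to full measure (`ae_frequently_of_measure_ne_zero`). -/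

theorem coe_pos (x : UnitIrrational) : 0 < (x : ℝ) :=
  lt_of_le_of_ne x.2.1.1 (x.2.2.ne_zero).symm

theorem coe_lt_one (x : UnitIrrational) : (x : ℝ) < 1 :=
  lt_of_le_of_ne x.2.1.2 x.2.2.ne_one

theorem one_div_eq (x : UnitIrrational) :
    1 / (x : ℝ) = (partialQuotient x : ℝ) + (gauss x : ℝ) := by
  have h0 : (0 : ℝ) ≤ 1 / (x : ℝ) := by have := coe_pos x; positivity
  have h1 : ((⌊1 / (x : ℝ)⌋₊ : ℕ) : ℝ) = ((⌊1 / (x : ℝ)⌋ : ℤ) : ℝ) :=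
    natCast_floor_eq_intCast_floor h0
  change 1 / (x : ℝ) = ((⌊1 / (x : ℝ)⌋₊ : ℕ) : ℝ) + Int.fract (1 / (x : ℝ))
  rw [h1, Int.floor_add_fract]

theorem one_le_partialQuotient (x : UnitIrrational) : 1 ≤ partialQuotient x := by
  refine Nat.le_floor ?_
  rw [Nat.cast_one, le_div_iff₀ (coe_pos x), one_mul]
  exact (coe_lt_one x).le

theorem mul_partialQuotient_add (x : UnitIrrational) :
    (x : ℝ) * ((partialQuotient x : ℝ) + (gauss x : ℝ)) = 1 := by
  rw [← one_div_eq]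
  exact mul_one_div_cancel (coe_pos x).ne'

/-- Numerator and denominator of the `n`-th convergent of `x`, the convergent `0 / 1` having
index `0`. -/
noncomputable def convPair : ℕ → UnitIrrational → ℕ × ℕ
  | 0, _ => (0, 1)
  | n + 1, x => ((convPair n (gauss x)).2,
      partialQuotient x * (convPair n (gauss x)).2 + (convPair n (gauss x)).1)

/-- The numerator of the `n`-th convergent. -/
noncomputable def convNum (n : ℕ) (x : UnitIrrational) : ℕ := (convPair n x).1

/-- The denominator of the `n`-th convergent. -/
noncomputable def convDen (n : ℕ) (x : UnitIrrational) : ℕ := (convPair n x).2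

@[simp] theorem convNum_zero (x : UnitIrrational) : convNum 0 x = 0 := rfl
@[simp] theorem convDen_zero (x : UnitIrrational) : convDen 0 x = 1 := rfl
theorem convNum_succ (n : ℕ) (x : UnitIrrational) :
    convNum (n + 1) x = convDen n (gauss x) := rfl
theorem convDen_succ (n : ℕ) (x : UnitIrrational) :
    convDen (n + 1) x = partialQuotient x * convDen n (gauss x) + convNum n (gauss x) := rfl

theorem coprime_convNum_convDen (n : ℕ) (x : UnitIrrational) :
    (convNum n x).Coprime (convDen n x) := by
  induction n generalizing x with
  | zero => simp
  | succ n ih =>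
    rw [convNum_succ, convDen_succ]
    simpa using (ih (gauss x)).symm

theorem convDen_gauss_le (n : ℕ) (x : UnitIrrational) :
    convDen n (gauss x) ≤ convDen (n + 1) x := by
  rw [convDen_succ]
  nlinarith [one_le_partialQuotient x, Nat.zero_le (convDen n (gauss x))]

theorem convDen_pos (n : ℕ) (x : UnitIrrational) : 0 < convDen n x := by
  induction n generalizing x with
  | zero => simp
  | succ n ih => exact (ih _).trans_le (convDen_gauss_le n x)

theorem convPair_le_succ (n : ℕ) (x : UnitIrrational) :
    convNum n x ≤ convNum (n + 1) x ∧ convDen n x ≤ convDen (n + 1) x := by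
  induction n generalizing x with
  | zero =>
    refine ⟨by simp, ?_⟩
    have := one_le_partialQuotient x
    simpa [convDen_succ] using this
  | succ n ih =>
    obtain ⟨h1, h2⟩ := ih (gauss x)
    refine ⟨h2, ?_⟩
    rw [convDen_succ, convDen_succ (n + 1)]
    gcongr

theorem convDen_mono (x : UnitIrrational) : Monotone fun n => convDen n x :=
  monotone_nat_of_le_succ fun n => (convPair_le_succ n x).2

/-- Two steps of the recursion give `q_(n+2)(x) ≥ q_(n+1)(Gx) + q_n(G²x) ≥ 2 q_n(G²x)`. -/
theorem two_pow_le_convDen (n : ℕ) (x : UnitIrrational) : 2 ^ n ≤ convDen (2 * n) x := by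
  induction n generalizing x with
  | zero => simp
  | succ n ih =>
    have h := ih (gauss (gauss x))
    have h1 := convDen_gauss_le (2 * n) (gauss x)
    have h2 : convDen (2 * n + 1 + 1) x = partialQuotient x * convDen (2 * n + 1) (gauss x)
      + convDen (2 * n) (gauss (gauss x)) := rfl
    have h3 := Nat.mul_le_mul_right (convDen (2 * n + 1) (gauss x)) (one_le_partialQuotient x)
    rw [show 2 * (n + 1) = 2 * n + 1 + 1 by ring, h2, pow_succ]
    omega

theorem two_pow_half_le_convDen (n : ℕ) (x : UnitIrrational) : 2 ^ (n / 2) ≤ convDen n x :=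
  (two_pow_le_convDen _ x).trans (convDen_mono x (Nat.mul_div_le n 2))

theorem tendsto_convDen (x : UnitIrrational) : Tendsto (fun n => convDen n x) atTop atTop := by
  refine tendsto_atTop_atTop_of_monotone (convDen_mono x) fun b => ⟨2 * b, ?_⟩
  exact (Nat.lt_two_pow_self).le.trans (two_pow_le_convDen b x)

theorem abs_convDen_mul_sub (n : ℕ) (x : UnitIrrational) :
    |(convDen n x : ℝ) * x - convNum n x| = ∏ i ∈ Finset.range (n + 1), (gauss^[i] x : ℝ) := by
  induction n generalizing x with
  | zero => simpa using (coe_pos x).le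
  | succ n ih =>
    rw [Finset.prod_range_succ']
    simp only [Function.iterate_succ, Function.comp_apply, Function.iterate_zero, id]
    rw [← ih (gauss x), convDen_succ, convNum_succ]
    refine Eq.trans ?_ (congrArg (_ * ·) (abs_of_pos (coe_pos x)))
    rw [← abs_mul, ← abs_neg]
    congr 1
    push_cast
    linear_combination -(convDen n (gauss x) : ℝ) * mul_partialQuotient_add x

/-- This is the Möbius formula for `x` in terms of `G^(n+1) x`, with its denominator identified as
the inverse of the orbit product. Since `0 < G^(n+1) x < 1` and `q_n ≤ q_(n+1)`, it traps `q_n`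
times the orbit product in `[1/2, 1]`. -/
theorem convPair_mul_prod (n : ℕ) (x : UnitIrrational) :
    ((convDen (n + 1) x : ℝ) + (gauss^[n + 1] x : ℝ) * convDen n x) *
        ∏ i ∈ Finset.range (n + 1), (gauss^[i] x : ℝ) = 1 ∧
    ((convNum (n + 1) x : ℝ) + (gauss^[n + 1] x : ℝ) * convNum n x) *
        ∏ i ∈ Finset.range (n + 1), (gauss^[i] x : ℝ) = x := by
  induction n generalizing x with
  | zero =>
    have := mul_partialQuotient_add x
    constructor
    · simp [convDen_succ]; linarith
    · simp [convNum_succ]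
  | succ n ih =>
    obtain ⟨h1, h2⟩ := ih (gauss x)
    have h3 := mul_partialQuotient_add x
    rw [Finset.prod_range_succ']
    simp only [Function.iterate_succ, Function.comp_apply, Function.iterate_zero, id] at h1 h2 ⊢
    rw [convDen_succ (n + 1), convDen_succ n x, convNum_succ (n + 1), convNum_succ n x]
    push_cast
    constructor
    · linear_combination h3 + (x : ℝ) * partialQuotient x * h1 + (x : ℝ) * h2
    · linear_combination (x : ℝ) * h1

theorem prod_iterate_pos (n : ℕ) (x : UnitIrrational) :
    0 < ∏ i ∈ Finset.range n, (gauss^[i] x : ℝ) :=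
  Finset.prod_pos fun _ _ => coe_pos _

theorem convDen_mul_prod_le_one (n : ℕ) (x : UnitIrrational) :
    (convDen n x : ℝ) * ∏ i ∈ Finset.range n, (gauss^[i] x : ℝ) ≤ 1 := by
  cases n with
  | zero => simp
  | succ n =>
    refine le_of_le_of_eq ?_ (convPair_mul_prod n x).1
    have := coe_pos (gauss^[n + 1] x)
    refine mul_le_mul_of_nonneg_right ?_ (prod_iterate_pos _ x).le
    have : (0 : ℝ) ≤ (gauss^[n + 1] x : ℝ) * convDen n x := by positivity
    linarith

theorem one_le_two_mul_convDen_mul_prod (n : ℕ) (x : UnitIrrational) :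
    1 ≤ 2 * (convDen n x : ℝ) * ∏ i ∈ Finset.range n, (gauss^[i] x : ℝ) := by
  cases n with
  | zero => simp
  | succ n =>
    refine le_of_eq_of_le (convPair_mul_prod n x).1.symm ?_
    refine mul_le_mul_of_nonneg_right ?_ (prod_iterate_pos _ x).le
    have h1 : (convDen n x : ℝ) ≤ convDen (n + 1) x := by
      exact_mod_cast (convPair_le_succ n x).2
    have h2 := coe_lt_one (gauss^[n + 1] x)
    have h3 : (0 : ℝ) ≤ convDen n x := by positivity
    nlinarith

theorem abs_sub_convergent_eq (n : ℕ) (x : UnitIrrational) :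
    |(x : ℝ) - (convNum n x : ℝ) / convDen n x| =
      (∏ i ∈ Finset.range n, (gauss^[i] x : ℝ)) * (gauss^[n] x : ℝ) / convDen n x := by
  have h : (0 : ℝ) < convDen n x := by exact_mod_cast convDen_pos n x
  rw [← Finset.prod_range_succ, ← abs_convDen_mul_sub, eq_div_iff h.ne']
  nth_rewrite 2 [← abs_of_pos h]
  rw [← abs_mul]
  congr 1
  field_simp

theorem abs_sub_convergent_le (n : ℕ) (x : UnitIrrational) :
    |(x : ℝ) - (convNum n x : ℝ) / convDen n x| ≤ (gauss^[n] x : ℝ) / (convDen n x : ℝ) ^ 2 := by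
  have h : (0 : ℝ) < convDen n x := by exact_mod_cast convDen_pos n x
  rw [abs_sub_convergent_eq, div_le_div_iff₀ h (by positivity)]
  have h1 := convDen_mul_prod_le_one n x
  have h2 : 0 ≤ (gauss^[n] x : ℝ) * convDen n x := mul_nonneg (coe_pos _).le h.le
  nlinarith [mul_le_mul_of_nonneg_left h1 h2]

theorem le_abs_sub_convergent (n : ℕ) (x : UnitIrrational) :
    (gauss^[n] x : ℝ) / (2 * (convDen n x : ℝ) ^ 2) ≤
      |(x : ℝ) - (convNum n x : ℝ) / convDen n x| := by
  have h : (0 : ℝ) < convDen n x := by exact_mod_cast convDen_pos n x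
  rw [abs_sub_convergent_eq, div_le_div_iff₀ (by positivity) h]
  have h1 := one_le_two_mul_convDen_mul_prod n x
  have h2 : 0 ≤ (gauss^[n] x : ℝ) * convDen n x := mul_nonneg (coe_pos _).le h.le
  nlinarith [mul_le_mul_of_nonneg_left h1 h2]

theorem convergent_add_gauss (a n : ℕ) (x : UnitIrrational) :
    Real.convergent ((a : ℝ) + x) n = a + Real.convergent x n := by
  have hf : ⌊(a : ℝ) + x⌋ = a := by
    rw [Int.floor_natCast_add, Int.floor_eq_zero_iff.2 ⟨(coe_pos x).le, coe_lt_one x⟩, add_zero]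
  have hf' : ⌊(x : ℝ)⌋ = 0 := Int.floor_eq_zero_iff.2 ⟨(coe_pos x).le, coe_lt_one x⟩
  cases n with
  | zero => simp [Real.convergent_zero, hf']
  | succ n =>
    rw [Real.convergent_succ, Real.convergent_succ, hf, hf', Int.fract_natCast_add]
    simp

theorem convergent_eq (n : ℕ) (x : UnitIrrational) :
    Real.convergent x n = (convNum n x : ℚ) / convDen n x := by
  have hf' : ⌊(x : ℝ)⌋ = 0 := Int.floor_eq_zero_iff.2 ⟨(coe_pos x).le, coe_lt_one x⟩
  induction n generalizing x with
  | zero => simp [Real.convergent_zero, hf']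
  | succ n ih =>
    have h : (convDen n (gauss x) : ℚ) ≠ 0 := by exact_mod_cast (convDen_pos n _).ne'
    have hfr : (Int.fract (x : ℝ))⁻¹ = (partialQuotient x : ℝ) + gauss x := by
      rw [Int.fract_eq_self.2 ⟨(coe_pos x).le, coe_lt_one x⟩, ← one_div, one_div_eq]
    rw [Real.convergent_succ, hf', hfr, convergent_add_gauss, ih (gauss x)
      (Int.floor_eq_zero_iff.2 ⟨(coe_pos _).le, coe_lt_one _⟩), convNum_succ, convDen_succ]
    push_cast
    rw [zero_add, ← inv_div]
    field_simp

theorem den_convergent (n : ℕ) (x : UnitIrrational) :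
    ((convNum n x : ℚ) / convDen n x).den = convDen n x := by
  have := Rat.den_div_eq_of_coprime (a := convNum n x) (b := convDen n x)
    (by exact_mod_cast convDen_pos n x) (by simpa using coprime_convNum_convDen n x)
  simpa using this

/-! ### Solutions of the Diophantine inequality -/

theorem finite_rat_den_lt_abs_sub_le (x K : ℝ) (D : ℕ) :
    {r : ℚ | r.den < D ∧ |x - r| ≤ K}.Finite := by
  have hfin : ((Icc ⌊-(D * (|x| + K))⌋ ⌈D * (|x| + K)⌉ : Set ℤ) ×ˢ (Iio D : Set ℕ)).Finite :=
    (finite_Icc _ _).prod (finite_Iio _)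
  refine (hfin.image fun p => (p.1 : ℚ) / p.2).subset ?_
  rintro r ⟨hd, hr⟩
  refine ⟨(r.num, r.den), ⟨?_, hd⟩, Rat.num_div_den r⟩
  have h1 : |(r : ℝ)| ≤ |x| + K := by
    have := abs_sub_abs_le_abs_sub (r : ℝ) x
    rw [abs_sub_comm] at this
    linarith
  have hdp : (0 : ℝ) < r.den := by exact_mod_cast r.den_pos
  have h2 : |(r.num : ℝ)| ≤ D * (|x| + K) := by
    have : (r.num : ℝ) = r.den * (r : ℝ) := by
      have := Rat.den_mul_eq_num r
      exact_mod_cast this.symm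
    rw [this, abs_mul, abs_of_pos hdp]
    gcongr
  obtain ⟨h3, h4⟩ := abs_le.1 h2
  constructor
  · have := (Int.floor_le (-(D * (|x| + K)))).trans h3
    exact_mod_cast this
  · have := h4.trans (Int.le_ceil _)
    exact_mod_cast this

variable {f : ℕ → ℝ}

/-- A solution need not be given in lowest terms. Writing the bound as `q f(q) / (c q^2)`,
monotonicity of `n f(n)` lets the reduced denominator replace `q`. -/
theorem abs_sub_lt_of_mem_solutions
    (hf_nonneg : ∀ n : ℕ, 1 ≤ n → 0 ≤ f n)
    (hf_anti : AntitoneOn (fun n : ℕ => (n : ℝ) * f n) (Set.Ici 1)) {c x : ℝ} (hc : 0 < c) {r : ℚ}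
    (hr : r ∈ solutions x fun q => f q / (c * (q : ℝ))) :
    |x - r| < (r.den : ℝ) * f r.den / (c * (r.den : ℝ) ^ 2) := by
  obtain ⟨p, q, hq, rfl, h⟩ := hr
  set r : ℚ := (p : ℚ) / q with hr
  have hdvd : r.den ∣ q := by
    have := Rat.den_dvd p q
    rw [Rat.divInt_eq_div, Int.cast_natCast, ← hr] at this
    exact_mod_cast this
  have hle : r.den ≤ q := Nat.le_of_dvd hq hdvd
  have hd1 : 1 ≤ r.den := r.den_pos
  have hq0 : (0 : ℝ) < q := by exact_mod_cast hq
  have hd0 : (0 : ℝ) < r.den := by exact_mod_cast hd1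
  have hle' : (r.den : ℝ) ≤ q := by exact_mod_cast hle
  have hcast : (r : ℝ) = (p : ℝ) / q := by rw [hr]; push_cast; rfl
  rw [hcast]
  refine h.trans_le ?_
  have h1 : (q : ℝ) * f q ≤ r.den * f r.den := hf_anti hd1 hq hle
  have h0 : 0 ≤ (r.den : ℝ) * f r.den := mul_nonneg hd0.le (hf_nonneg _ hd1)
  calc f q / (c * q) = (q * f q) / (c * (q : ℝ) ^ 2) := by field_simp
    _ ≤ (r.den * f r.den) / (c * (q : ℝ) ^ 2) := by gcongr
    _ ≤ _ := by gcongr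

theorem finite_solutions_of_eventually
    (hf_nonneg : ∀ n : ℕ, 1 ≤ n → 0 ≤ f n)
    (hf_anti : AntitoneOn (fun n : ℕ => (n : ℝ) * f n) (Set.Ici 1))
    (hf_lim : Tendsto (fun n : ℕ => (n : ℝ) * f n) atTop (𝓝 0)) {c : ℝ} (hc : 2 ≤ c)
    (x : UnitIrrational)
    (hx : ∀ᶠ n in atTop, (convDen n x : ℝ) * f (convDen n x) ≤ (gauss^[n] x : ℝ)) :
    (solutions (x : ℝ) fun q => f q / (c * (q : ℝ))).Finite := by
  have hc0 : 0 < c := by linarith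
  obtain ⟨D, hD⟩ := eventually_atTop.1 (hf_lim.eventually_lt_const (zero_lt_one))
  obtain ⟨N, hN⟩ := eventually_atTop.1 hx
  -- Denominators below `D` leave finitely many rationals near `x`. From `D` on, `q f(q) < 1` and `c
  -- ≥ 2` put the solution within Legendre's bound `1 / (2 q^2)`.
  refine ((finite_rat_den_lt_abs_sub_le x (1 * f 1) D).union
    ((finite_Iio N).image fun n => Real.convergent x n)).subset fun r hr => ?_
  have h := abs_sub_lt_of_mem_solutions hf_nonneg hf_anti hc0 hr
  have hd1 : 1 ≤ r.den := r.den_pos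
  have hd1' : (1 : ℝ) ≤ r.den := by exact_mod_cast hd1
  have h0 : 0 ≤ (r.den : ℝ) * f r.den := mul_nonneg (by positivity) (hf_nonneg _ hd1)
  rcases lt_or_ge r.den D with hlt | hge
  · left
    refine ⟨hlt, h.le.trans ?_⟩
    refine (div_le_self h0 ?_).trans (by simpa using hf_anti (mem_Ici.2 le_rfl) hd1 hd1)
    nlinarith
  · right
    have hlt : |(x : ℝ) - r| < 1 / (2 * (r.den : ℝ) ^ 2) := by
      refine h.trans_le ?_
      have := (hD _ hge).le
      gcongr
    obtain ⟨n, hn⟩ := Real.exists_rat_eq_convergent hlt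
    refine ⟨n, ?_, hn.symm⟩
    by_contra hnN
    rw [mem_Iio, not_lt] at hnN
    have hr' : r = (convNum n x : ℚ) / convDen n x := hn.trans (convergent_eq n x)
    have hden : r.den = convDen n x := by rw [hr', den_convergent]
    rw [hden] at h h0
    have h1 := le_abs_sub_convergent n x
    have hcast : (r : ℝ) = (convNum n x : ℝ) / convDen n x := by rw [hr']; push_cast; rfl
    rw [← hcast] at h1
    have h2 := h1.trans_lt h
    have hp : (0 : ℝ) < convDen n x := by exact_mod_cast convDen_pos n x
    have h3 : (convDen n x : ℝ) * f (convDen n x) / (c * (convDen n x : ℝ) ^ 2) ≤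
      (convDen n x : ℝ) * f (convDen n x) / (2 * (convDen n x : ℝ) ^ 2) := by gcongr
    have h4 := h2.trans_le h3
    rw [div_lt_div_iff_of_pos_right (by positivity)] at h4
    exact absurd (hN n hnN) (not_le.2 h4)

theorem infinite_solutions_of_frequently (x : UnitIrrational)
    (hx : ∃ᶠ n in atTop, (gauss^[n] x : ℝ) < (convDen n x : ℝ) * f (convDen n x)) :
    (solutions (x : ℝ) fun q => f q / (q : ℝ)).Infinite := by
  intro hfin
  have hb := (hfin.image Rat.den).bddAbove
  obtain ⟨B, hB⟩ := hb
  obtain ⟨n, hn, hBn⟩ := (hx.and_eventually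
    ((tendsto_convDen x).eventually_gt_atTop B)).exists
  have hp : (0 : ℝ) < convDen n x := by exact_mod_cast convDen_pos n x
  have hmem : ((convNum n x : ℚ) / convDen n x) ∈ solutions (x : ℝ) fun q => f q / (q : ℝ) := by
    refine ⟨convNum n x, convDen n x, convDen_pos n x, by push_cast; rfl, ?_⟩
    rw [Int.cast_natCast]
    refine (abs_sub_convergent_le n x).trans_lt ?_
    rw [div_lt_div_iff₀ (by positivity) hp]
    nlinarith
  have := hB (mem_image_of_mem Rat.den hmem)
  rw [den_convergent] at this
  omega


/-! ### Cylinders -/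

theorem measurable_partialQuotient : Measurable partialQuotient :=
  Nat.measurable_floor.comp (measurable_subtype_coe.const_div 1)

theorem measurable_gauss : Measurable gauss :=
  Measurable.subtype_mk (measurable_fract.comp (measurable_subtype_coe.const_div 1))

theorem partialQuotient_anti {x y : UnitIrrational} (h : (x : ℝ) ≤ y) :
    partialQuotient y ≤ partialQuotient x :=
  Nat.floor_mono (one_div_le_one_div_of_le (coe_pos x) h)

theorem gauss_anti {x y : UnitIrrational} (h : (x : ℝ) ≤ y)
    (hxy : partialQuotient x = partialQuotient y) : (gauss y : ℝ) ≤ gauss x := by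
  have h1 := one_div_le_one_div_of_le (coe_pos x) h
  rw [one_div_eq, one_div_eq, hxy] at h1
  linarith

/-- The cylinder of rank `n` that contains `x`. -/
def cyl (n : ℕ) (x : UnitIrrational) : Set UnitIrrational :=
  {y | ∀ k < n, partialQuotient (gauss^[k] y) = partialQuotient (gauss^[k] x)}

theorem mem_cyl_self (n : ℕ) (x : UnitIrrational) : x ∈ cyl n x := fun _ _ => rfl

theorem mem_cyl_comm {n : ℕ} {x y : UnitIrrational} : y ∈ cyl n x ↔ x ∈ cyl n y :=
  ⟨fun h k hk => (h k hk).symm, fun h k hk => (h k hk).symm⟩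

theorem mem_cyl_trans {n : ℕ} {x y z : UnitIrrational} (h : z ∈ cyl n y) (h' : y ∈ cyl n x) :
    z ∈ cyl n x := fun k hk => (h k hk).trans (h' k hk)

theorem cyl_add (m n : ℕ) (x : UnitIrrational) :
    cyl (m + n) x = cyl m x ∩ gauss^[m] ⁻¹' cyl n (gauss^[m] x) := by
  ext y
  simp only [cyl, mem_ofPred_eq, mem_inter_iff, mem_preimage, ← Function.iterate_add_apply]
  constructor
  · exact fun h => ⟨fun k hk => h k (by omega), fun k hk => h (k + m) (by omega)⟩
  · rintro ⟨h1, h2⟩ k hk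
    rcases lt_or_ge k m with h | h
    · exact h1 k h
    · obtain ⟨j, rfl⟩ := Nat.exists_eq_add_of_le' h
      exact h2 j (by omega)

theorem cyl_anti (x : UnitIrrational) : Antitone fun n => cyl n x :=
  fun _ _ hmn _ hy k hk => hy k (hk.trans_le hmn)

theorem mem_cyl_succ {n : ℕ} {x y : UnitIrrational} :
    y ∈ cyl (n + 1) x ↔
      partialQuotient y = partialQuotient x ∧ gauss y ∈ cyl n (gauss x) := by
  rw [add_comm, cyl_add]
  simp [cyl]

/-- Cylinders are order-convex: `G` is decreasing on each cylinder of rank one, so the two endpoints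
swap roles at every step of the induction. -/
theorem mem_cyl_of_le_of_le {n : ℕ} {x w y z : UnitIrrational} (hw : w ∈ cyl n x)
    (hz : z ∈ cyl n x) (hwy : (w : ℝ) ≤ y) (hyz : (y : ℝ) ≤ z) : y ∈ cyl n x := by
  induction n generalizing x w y z with
  | zero => exact fun k hk => absurd hk (Nat.not_lt_zero k)
  | succ n ih =>
    rw [mem_cyl_succ] at hw hz ⊢
    have h1 := partialQuotient_anti hwy
    have h2 := partialQuotient_anti hyz
    have h3 : partialQuotient y = partialQuotient x := by omega
    exact ⟨h3, ih hz.2 hw.2 (gauss_anti hyz (by omega)) (gauss_anti hwy (by omega))⟩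

theorem generateFrom_cylinders_le (n : ℕ) :
    MeasurableSpace.generateFrom (cylinders n) ≤
      (inferInstance : MeasurableSpace UnitIrrational) := by
  refine MeasurableSpace.generateFrom_le ?_
  rintro _ ⟨s, rfl⟩
  change MeasurableSet {x : UnitIrrational |
    ∀ k : Fin n, partialQuotient (gauss^[(k : ℕ)] x) = s k}
  rw [ofPred_forall]
  exact MeasurableSet.iInter fun k =>
    (measurable_partialQuotient.comp (measurable_gauss.iterate k)) (measurableSet_singleton (s k))

/-- A set saturated under the cylinder relation is a union of cylinders, and there are only
countably many. -/
theorem measurableSet_generateFrom_cylinders {n : ℕ} {S : Set UnitIrrational}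
    (hS : ∀ x ∈ S, cyl n x ⊆ S) :
    MeasurableSet[MeasurableSpace.generateFrom (cylinders n)] S := by
  let c : (Fin n → ℕ) → Set UnitIrrational :=
    fun s => {x | ∀ k : Fin n, partialQuotient (gauss^[(k : ℕ)] x) = s k}
  have hSeq : S = ⋃ s ∈ {s : Fin n → ℕ | c s ⊆ S}, c s := by
    refine Subset.antisymm (fun x hx => ?_) (iUnion₂_subset fun s hs => hs)
    refine mem_iUnion₂.2 ⟨fun k => partialQuotient (gauss^[(k : ℕ)] x), ?_, fun k => rfl⟩
    exact fun y hy => hS x hx fun k hk => hy ⟨k, hk⟩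
  rw [hSeq]
  exact MeasurableSet.biUnion (to_countable _) fun s _ =>
    MeasurableSpace.measurableSet_generateFrom ⟨s, rfl⟩

theorem measurableSet_cyl (n : ℕ) (x : UnitIrrational) :
    MeasurableSet[MeasurableSpace.generateFrom (cylinders n)] (cyl n x) :=
  measurableSet_generateFrom_cylinders fun _ hy _ hz => mem_cyl_trans hz hy

theorem convPair_congr {n : ℕ} {x y : UnitIrrational} (h : y ∈ cyl n x) :
    convPair n y = convPair n x := by
  induction n generalizing x y with
  | zero => rfl
  | succ n ih =>
    obtain ⟨h1, h2⟩ := mem_cyl_succ.1 h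
    simp only [convPair, h1, ih h2]

theorem measurableSet_lt_convDen (n a : ℕ) :
    MeasurableSet[MeasurableSpace.generateFrom (cylinders n)] {x | a < convDen n x} := by
  refine measurableSet_generateFrom_cylinders fun x hx y hy => ?_
  rw [mem_ofPred_eq, convDen, convPair_congr hy]
  exact hx

theorem measurable_convDen (n : ℕ) : Measurable (convDen n) := by
  refine measurable_to_countable' fun a => ?_
  refine generateFrom_cylinders_le n _ (measurableSet_generateFrom_cylinders fun x hx y hy => ?_)
  rw [mem_preimage, convDen, convPair_congr hy]
  exact hx

/-- The points of `𝕀` smaller than `t`. -/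
def below (t : ℝ) : Set UnitIrrational := {x | (x : ℝ) < t}

theorem measurableSet_below (t : ℝ) : MeasurableSet (below t) :=
  measurableSet_lt measurable_subtype_coe measurable_const

theorem below_mono {s t : ℝ} (h : s ≤ t) : below s ⊆ below t := fun _ hx => lt_of_lt_of_le hx h

theorem setOf_mem_Ioo_eq_below (t : ℝ) :
    {x : UnitIrrational | (x : ℝ) ∈ Ioo (0 : ℝ) t} = below t := by
  ext x
  simp [below, coe_pos x]

/-- The union of the cylinders of rank `n` that meet `below t`. -/
def hull (n : ℕ) (t : ℝ) : Set UnitIrrational := {x | ∃ y ∈ cyl n x, (y : ℝ) < t}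

theorem below_subset_hull (n : ℕ) (t : ℝ) : below t ⊆ hull n t :=
  fun x hx => ⟨x, mem_cyl_self n x, hx⟩

theorem measurableSet_hull (n : ℕ) (t : ℝ) :
    MeasurableSet[MeasurableSpace.generateFrom (cylinders n)] (hull n t) :=
  measurableSet_generateFrom_cylinders fun _ ⟨y, hy, hyt⟩ _ hz =>
    ⟨y, mem_cyl_trans hy (mem_cyl_comm.1 hz), hyt⟩

/-- By convexity only one cylinder can have points on both sides of `t`, so the hull exceeds `below
t` by at most that cylinder. -/
theorem hull_diff_below_subset_cyl {n : ℕ} {t : ℝ} {z : UnitIrrational}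
    (hz : z ∈ hull n t \ below t) : hull n t \ below t ⊆ cyl n z := by
  rintro w ⟨⟨y, hy, hyt⟩, hwt⟩
  obtain ⟨⟨y', hy', hyt'⟩, hzt⟩ := hz
  simp only [below, mem_ofPred_eq, not_lt] at hwt hzt
  rcases le_total (y : ℝ) y' with h | h
  · exact mem_cyl_trans (mem_cyl_comm.1 (mem_cyl_of_le_of_le hy (mem_cyl_self n w) h
      (hyt'.le.trans hwt))) hy'
  · exact mem_cyl_trans (mem_cyl_comm.1 hy) (mem_cyl_of_le_of_le hy' (mem_cyl_self n z) h
      (hyt.le.trans hzt))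

theorem measureReal_hull_le (μ : Measure UnitIrrational) [IsProbabilityMeasure μ] {n : ℕ} {c : ℝ}
    (hc : ∀ x, μ.real (cyl n x) ≤ c) (t : ℝ) :
    μ.real (hull n t) ≤ μ.real (below t) + c := by
  have h1 : μ.real (hull n t) ≤ μ.real (below t) + μ.real (hull n t \ below t) := by
    refine (measureReal_mono ?_).trans (measureReal_union_le _ _)
    rw [union_sdiff_self]
    exact subset_union_right
  refine h1.trans (add_le_add_right ?_ _)
  rcases (hull n t \ below t).eq_empty_or_nonempty with h | ⟨z, hz⟩
  · rw [h, measureReal_empty]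
    obtain ⟨x⟩ := nonempty_of_isProbabilityMeasure μ
    exact measureReal_nonneg.trans (hc x)
  · exact (measureReal_mono (hull_diff_below_subset_cyl hz)).trans (hc z)

/-! ### Borel–Cantelli with a second moment bound -/

/-- With `N` the number of sets containing a point and `U` their union, integrate the pointwise
inequality `2 K S N ≤ N^2 + (K S)^2 1_U`, then divide by `K S^2`. -/
theorem one_div_le_measureReal_biUnion {Ω : Type*} [MeasurableSpace Ω] (μ : Measure Ω)
    [IsProbabilityMeasure μ] {F : ℕ → Set Ω} (hF : ∀ i, MeasurableSet (F i)) (s : Finset ℕ)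
    {K : ℝ} (hK : 0 < K) (hS : 0 < ∑ i ∈ s, μ.real (F i))
    (h : ∑ i ∈ s, ∑ j ∈ s, μ.real (F i ∩ F j) ≤ K * (∑ i ∈ s, μ.real (F i)) ^ 2) :
    1 / K ≤ μ.real (⋃ i ∈ s, F i) := by
  set S := ∑ i ∈ s, μ.real (F i) with hSdef
  have hU : MeasurableSet (⋃ i ∈ s, F i) := s.measurableSet_biUnion fun i _ => hF i
  have hint : ∀ A : Set Ω, MeasurableSet A → Integrable (A.indicator (1 : Ω → ℝ)) μ :=
    fun A hA => (integrable_const (1 : ℝ)).indicator hA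
  have key : ∫ x, 2 * (K * S) * ∑ i ∈ s, (F i).indicator (1 : Ω → ℝ) x ∂μ ≤
      ∫ x, (∑ i ∈ s, ∑ j ∈ s, (F i ∩ F j).indicator (1 : Ω → ℝ) x) +
        (K * S) ^ 2 * (⋃ i ∈ s, F i).indicator (1 : Ω → ℝ) x ∂μ := by
    refine integral_mono ?_ ?_ fun x => ?_
    · exact (integrable_finsetSum _ fun i _ => hint _ (hF i)).const_mul _
    · exact (integrable_finsetSum _ fun i _ => integrable_finsetSum _ fun j _ =>
        hint _ ((hF i).inter (hF j))).add ((hint _ hU).const_mul _)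
    · have h2 : ∑ i ∈ s, ∑ j ∈ s, (F i ∩ F j).indicator (1 : Ω → ℝ) x =
          (∑ i ∈ s, (F i).indicator (1 : Ω → ℝ) x) ^ 2 := by
        rw [sq, Finset.sum_mul_sum]
        simp_rw [inter_indicator_one, Pi.mul_apply]
      dsimp only
      rw [h2]
      by_cases hx : x ∈ ⋃ i ∈ s, F i
      · rw [indicator_of_mem hx, Pi.one_apply]
        nlinarith [sq_nonneg ((∑ i ∈ s, (F i).indicator (1 : Ω → ℝ) x) - K * S)]
      · rw [indicator_of_notMem hx]
        have : ∑ i ∈ s, (F i).indicator (1 : Ω → ℝ) x = 0 := by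
          refine Finset.sum_eq_zero fun i hi => indicator_of_notMem ?_ _
          exact fun hxi => hx (mem_biUnion hi hxi)
        rw [this]
        simp
  rw [integral_const_mul, integral_add
    (integrable_finsetSum _ fun i _ => integrable_finsetSum _ fun j _ =>
        hint _ ((hF i).inter (hF j))) ((hint _ hU).const_mul _), integral_const_mul,
    integral_finsetSum _ fun i _ => hint _ (hF i), integral_indicator_one hU,
    integral_finsetSum _ fun i _ => integrable_finsetSum _ fun j _ =>
        hint _ ((hF i).inter (hF j))] at key
  have e1 : ∀ i ∈ s, ∫ x, ∑ j ∈ s, (F i ∩ F j).indicator (1 : Ω → ℝ) x ∂μ =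
      ∑ j ∈ s, μ.real (F i ∩ F j) := fun i _ => by
    rw [integral_finsetSum _ fun j _ => hint _ ((hF i).inter (hF j))]
    exact Finset.sum_congr rfl fun j _ => integral_indicator_one ((hF i).inter (hF j))
  rw [Finset.sum_congr rfl e1, Finset.sum_congr rfl fun i _ => integral_indicator_one (hF i),
    ← hSdef] at key
  rw [div_le_iff₀ hK]
  have h3 : K * S ^ 2 * 1 ≤ K * S ^ 2 * (μ.real (⋃ i ∈ s, F i) * K) := by linarith
  exact le_of_mul_le_mul_left h3 (by positivity)

theorem measure_frequently_pos {Ω : Type*} [MeasurableSpace Ω] (μ : Measure Ω)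
    [IsProbabilityMeasure μ] {F : ℕ → Set Ω} (hF : ∀ i, MeasurableSet (F i))
    {K : ℝ} (hK : 0 < K)
    (h : ∀ M, ∃ s : Finset ℕ, (∀ i ∈ s, M ≤ i) ∧ 0 < ∑ i ∈ s, μ.real (F i) ∧
      ∑ i ∈ s, ∑ j ∈ s, μ.real (F i ∩ F j) ≤ K * (∑ i ∈ s, μ.real (F i)) ^ 2) :
    0 < μ {x | ∃ᶠ i in atTop, x ∈ F i} := by
  have heq : {x | ∃ᶠ i in atTop, x ∈ F i} = ⋂ M : ℕ, ⋃ i ≥ M, F i := by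
    ext x
    simp [frequently_atTop]
  have hanti : Antitone fun M : ℕ => ⋃ i ≥ M, F i :=
    fun M N hMN => biUnion_mono (fun i hi => le_trans hMN hi) fun _ _ => Subset.rfl
  have ht := tendsto_measure_iInter_atTop (μ := μ) (s := fun M : ℕ => ⋃ i ≥ M, F i)
    (fun M => (MeasurableSet.biUnion (to_countable _) fun i _ => hF i).nullMeasurableSet) hanti
    ⟨0, measure_ne_top _ _⟩
  rw [heq]
  refine lt_of_lt_of_le (ENNReal.ofReal_pos.2 (one_div_pos.2 hK)) (ge_of_tendsto' ht fun M => ?_)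
  obtain ⟨s, hs, hS, hle⟩ := h M
  refine (ENNReal.ofReal_le_ofReal (one_div_le_measureReal_biUnion μ hF s hK hS hle)).trans ?_
  rw [ofReal_measureReal (measure_ne_top _ _)]
  exact measure_mono (biUnion_mono hs fun _ _ => Subset.rfl)


/-! ### Decay of cylinders -/

theorem IsWeakRenyi.exists_measureReal_le {μ : Measure UnitIrrational} [IsProbabilityMeasure μ]
    (hμ : IsWeakRenyi μ) : ∃ C : ℝ, 1 < C ∧ ∀ n : ℕ, 1 ≤ n → ∀ A B : Set UnitIrrational,
      MeasurableSet[MeasurableSpace.generateFrom (cylinders n)] A → MeasurableSet B →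
        μ.real (A ∩ gauss^[n] ⁻¹' B) ≤ C * μ.real A * μ.real B := by
  obtain ⟨C, hC, h⟩ := hμ.bound
  refine ⟨C, hC, fun n hn A B hA hB => ?_⟩
  have := ENNReal.toReal_mono (by finiteness) (h n hn A B hA hB)
  rwa [ENNReal.toReal_mul, ENNReal.toReal_mul, ENNReal.toReal_ofReal (by linarith)] at this

/-- Otherwise compactness from above yields a point `x` all of whose cylinders have measure at least
`ε`. By invariance the rank-one cylinders along its orbit are as large, so its digits are bounded by
some `m`. The points with all digits below `m` then form a forward invariant set of positive, hence
full, measure, which contradicts `hpos`. -/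
theorem exists_measureReal_cyl_lt {μ : Measure UnitIrrational} [IsProbabilityMeasure μ]
    (hE : Ergodic gauss μ) (hpos : ∀ m : ℕ, μ {x | m ≤ partialQuotient x} ≠ 0)
    {ε : ℝ} (hε : 0 < ε) : ∃ n, ∀ x, μ.real (cyl n x) < ε := by
  by_contra! hcon
  have hmeas : ∀ n x, MeasurableSet (cyl n x) := fun n x =>
    generateFrom_cylinders_le n _ (measurableSet_cyl n x)
  let U : ℕ → Set UnitIrrational := fun n => {x | ε ≤ μ.real (cyl n x)}
  have hUmeas : ∀ n, MeasurableSet (U n) := fun n => by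
    refine generateFrom_cylinders_le n _ (measurableSet_generateFrom_cylinders ?_)
    intro x hx y hy
    exact le_trans hx (measureReal_mono fun z hz => mem_cyl_trans hz (mem_cyl_comm.1 hy))
  have hUanti : Antitone U := fun m n hmn x hx =>
    show ε ≤ μ.real (cyl m x) from le_trans hx (measureReal_mono (cyl_anti x hmn))
  have hUge : ∀ n, ENNReal.ofReal ε ≤ μ (U n) := fun n => by
    obtain ⟨x, hx⟩ := hcon n
    refine (ENNReal.ofReal_le_ofReal hx).trans ?_
    rw [ofReal_measureReal (measure_ne_top _ _)]
    refine measure_mono fun y hy => hx.trans (measureReal_mono fun z hz => ?_)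
    exact mem_cyl_trans hz (mem_cyl_comm.1 hy)
  have hε' : 0 < ENNReal.ofReal ε := ENNReal.ofReal_pos.2 hε
  have hUinter : (⋂ n, U n).Nonempty := by
    refine nonempty_of_measure_ne_zero (μ := μ) (lt_of_lt_of_le hε' ?_).ne'
    exact ge_of_tendsto' (tendsto_measure_iInter_atTop
      (fun n => (hUmeas n).nullMeasurableSet) hUanti ⟨0, measure_ne_top _ _⟩) hUge
  obtain ⟨x, hx⟩ := hUinter
  have hx' : ∀ n, ε ≤ μ.real (cyl n x) := fun n => mem_iInter.1 hx n
  have hshift : ∀ i, ε ≤ μ.real (cyl 1 (gauss^[i] x)) := fun i => by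
    refine (hx' (i + 1)).trans ?_
    rw [cyl_add]
    refine (measureReal_mono inter_subset_right).trans (le_of_eq ?_)
    exact (hE.toMeasurePreserving.iterate i).measureReal_preimage (hmeas _ _).nullMeasurableSet
  obtain ⟨m, hm⟩ : ∃ m : ℕ, μ {x | m ≤ partialQuotient x} < ENNReal.ofReal ε := by
    have hanti : Antitone fun m : ℕ => {x | m ≤ partialQuotient x} :=
      fun a b hab y hy => le_trans hab hy
    have ht := tendsto_measure_iInter_atTop (μ := μ)
      (s := fun m : ℕ => {x | m ≤ partialQuotient x}) (fun m => (measurable_partialQuotient measurableSet_Ici).nullMeasurableSet) hanti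
      ⟨0, measure_ne_top _ _⟩
    have hemp : ⋂ m : ℕ, {x | m ≤ partialQuotient x} = ∅ := by
      refine eq_empty_of_forall_notMem fun y hy => ?_
      exact absurd (mem_iInter.1 hy (partialQuotient y + 1)) (Nat.not_succ_le_self _)
    rw [hemp, measure_empty] at ht
    exact (ht.eventually_lt_const hε').exists
  have hdig : ∀ i, partialQuotient (gauss^[i] x) < m := fun i => by
    by_contra! hi
    refine absurd (ENNReal.ofReal_le_ofReal (hshift i)) (not_le.2 (lt_of_le_of_lt ?_ hm))
    rw [ofReal_measureReal (measure_ne_top _ _)]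
    refine measure_mono fun y hy => ?_
    have := hy 0 one_pos
    simp only [Function.iterate_zero, id] at this
    rwa [mem_ofPred_eq, this]
  let F : Set UnitIrrational := {y | ∀ n, partialQuotient (gauss^[n] y) < m}
  have hFmeas : MeasurableSet F := by
    change MeasurableSet {y : UnitIrrational | ∀ n, partialQuotient (gauss^[n] y) < m}
    rw [ofPred_forall]
    exact MeasurableSet.iInter fun n =>
      (measurable_partialQuotient.comp (measurable_gauss.iterate n)) measurableSet_Iio
  have hFinv : F ⊆ gauss ⁻¹' F := fun y hy n => by
    rw [← Function.iterate_succ_apply]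
    exact hy (n + 1)
  have hFpos : μ F ≠ 0 := by
    have hsub : ⋂ n, cyl n x ⊆ F := fun y hy n => by
      rw [mem_iInter.1 hy (n + 1) n n.lt_succ_self]
      exact hdig n
    refine (lt_of_lt_of_le hε' (le_trans ?_ (measure_mono hsub))).ne'
    refine ge_of_tendsto' (tendsto_measure_iInter_atTop
      (fun n => (hmeas n x).nullMeasurableSet) (cyl_anti x) ⟨0, measure_ne_top _ _⟩) fun n => ?_
    rw [Function.comp_apply, ← ofReal_measureReal (measure_ne_top _ _)]
    exact ENNReal.ofReal_le_ofReal (hx' n)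
  rcases hE.ae_empty_or_univ_of_ae_le_preimage hFmeas.nullMeasurableSet
    hFinv.eventuallyLE with h | h
  · exact hFpos (by rw [measure_congr h, measure_empty])
  · refine hpos m (measure_mono_null (fun y hy => ?_) (ae_eq_univ.1 h))
    exact fun hyF => absurd (hyF 0) (not_lt.2 hy)

theorem exists_measureReal_cyl_le_pow {μ : Measure UnitIrrational} [IsProbabilityMeasure μ]
    (hE : Ergodic gauss μ) (hpos : ∀ m : ℕ, μ {x | m ≤ partialQuotient x} ≠ 0)
    {C : ℝ} (hC1 : 1 < C)
    (hC : ∀ n : ℕ, 1 ≤ n → ∀ A B : Set UnitIrrational,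
      MeasurableSet[MeasurableSpace.generateFrom (cylinders n)] A → MeasurableSet B →
        μ.real (A ∩ gauss^[n] ⁻¹' B) ≤ C * μ.real A * μ.real B) :
    ∃ r, 1 ≤ r ∧ ∀ k x, μ.real (cyl (r * k) x) ≤ (1 / 2) ^ k := by
  -- The choice `1 / (2 C)` absorbs the Renyi constant, so each further block of `r` digits at least
  -- halves the measure.
  obtain ⟨r, hr⟩ := exists_measureReal_cyl_lt hE hpos (ε := 1 / (2 * C)) (by positivity)
  have hr1 : 1 ≤ r := by
    rw [Nat.one_le_iff_ne_zero]
    rintro rfl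
    obtain ⟨x⟩ := nonempty_of_isProbabilityMeasure μ
    have h := hr x
    have huniv : cyl 0 x = univ := eq_univ_of_forall fun y k hk => absurd hk (Nat.not_lt_zero k)
    rw [huniv, probReal_univ, lt_div_iff₀ (by positivity)] at h
    linarith
  refine ⟨r, hr1, fun k => ?_⟩
  induction k with
  | zero => exact fun x => by simp
  | succ k ih =>
    intro x
    rw [mul_add, mul_one, add_comm, cyl_add]
    refine (hC r hr1 _ _ (measurableSet_cyl _ _)
      (generateFrom_cylinders_le _ _ (measurableSet_cyl _ _))).trans ?_
    have h1 : C * μ.real (cyl r x) ≤ 1 / 2 := by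
      have := (hr x).le
      rw [le_div_iff₀ (by positivity)] at this
      linarith
    rw [pow_succ']
    exact mul_le_mul h1 (ih _) measureReal_nonneg (by norm_num)

/-! ### Growth of the denominators -/

theorem log_one_div_nonneg (x : UnitIrrational) : 0 ≤ Real.log (1 / (x : ℝ)) :=
  Real.log_nonneg ((one_le_div (coe_pos x)).2 (coe_lt_one x).le)

theorem integrable_log_one_div {μ : Measure UnitIrrational} (h : expLog μ < ∞) :
    Integrable (fun x : UnitIrrational => Real.log (1 / (x : ℝ))) μ := by
  refine ⟨(Real.measurable_log.comp
    (measurable_subtype_coe.const_div 1)).aestronglyMeasurable, ?_⟩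
  rw [hasFiniteIntegral_iff_ofReal (Eventually.of_forall log_one_div_nonneg)]
  refine lt_of_le_of_lt ?_ h
  rw [expLog, two_mul]
  exact le_self_add

theorem log_convDen_le (n : ℕ) (x : UnitIrrational) :
    Real.log (convDen n x) ≤ ∑ i ∈ Finset.range n, Real.log (1 / (gauss^[i] x : ℝ)) := by
  have hd : (0 : ℝ) < convDen n x := by exact_mod_cast convDen_pos n x
  have h := Real.log_nonpos (mul_pos hd (prod_iterate_pos n x)).le (convDen_mul_prod_le_one n x)
  rw [Real.log_mul hd.ne' (prod_iterate_pos n x).ne',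
    Real.log_prod fun i _ => (coe_pos (gauss^[i] x)).ne'] at h
  simp_rw [one_div, Real.log_inv, Finset.sum_neg_distrib]
  linarith

/-- Markov's inequality for a sum of `r i` terms of equal mean against the threshold `i log L`: the
factor `i` cancels, so the bound is uniform in `i`. -/
theorem measureReal_pow_lt_convDen_le {μ : Measure UnitIrrational} [IsProbabilityMeasure μ]
    (hG : MeasurePreserving gauss μ μ) (h : expLog μ < ∞) {L : ℕ} (hL : 2 ≤ L) (r : ℕ) {i : ℕ}
    (hi : 1 ≤ i) :
    μ.real {x | L ^ i < convDen (r * i) x} ≤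
      r * (∫ x : UnitIrrational, Real.log (1 / (x : ℝ)) ∂μ) / Real.log L := by
  have hint := integrable_log_one_div h
  have hint' : ∀ k : ℕ, Integrable
      (fun x : UnitIrrational => Real.log (1 / (gauss^[k] x : ℝ))) μ := fun k =>
    (hG.iterate k).integrable_comp_of_integrable hint
  have heq : ∀ k : ℕ, ∫ x : UnitIrrational, Real.log (1 / (gauss^[k] x : ℝ)) ∂μ =
      ∫ x : UnitIrrational, Real.log (1 / (x : ℝ)) ∂μ := fun k => by
    have hk := hG.iterate k
    conv_rhs => rw [← hk.map_eq]
    rw [integral_map hk.measurable.aemeasurable]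
    rw [hk.map_eq]
    exact hint.aestronglyMeasurable
  have hL2 : (2 : ℝ) ≤ L := by exact_mod_cast hL
  have hlog : 0 < Real.log L := Real.log_pos (by linarith)
  have hi0 : (0 : ℝ) < i := by exact_mod_cast hi
  have hmk := mul_meas_ge_le_integral_of_nonneg
    (Eventually.of_forall fun x => Finset.sum_nonneg fun k _ => log_one_div_nonneg (gauss^[k] x))
    (integrable_finsetSum (Finset.range (r * i)) fun k _ => hint' k) (i * Real.log L)
  rw [integral_finsetSum _ fun k _ => hint' k, Finset.sum_congr rfl fun k _ => heq k,
    Finset.sum_const, Finset.card_range, nsmul_eq_mul] at hmk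
  have hsub : μ.real {x | L ^ i < convDen (r * i) x} ≤ μ.real {x : UnitIrrational |
      i * Real.log L ≤ ∑ k ∈ Finset.range (r * i), Real.log (1 / (gauss^[k] x : ℝ))} := by
    refine measureReal_mono fun x hx => le_trans ?_ (log_convDen_le (r * i) x)
    rw [← Real.log_pow]
    refine Real.log_le_log (by positivity) ?_
    have : L ^ i ≤ convDen (r * i) x := le_of_lt hx
    exact_mod_cast this
  rw [le_div_iff₀ hlog]
  refine le_of_mul_le_mul_left ?_ hi0
  push_cast at hmk
  calc (i : ℝ) * (μ.real {x | L ^ i < convDen (r * i) x} * Real.log L)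
      = i * Real.log L * μ.real {x | L ^ i < convDen (r * i) x} := by ring
    _ ≤ i * Real.log L * μ.real {x : UnitIrrational |
      i * Real.log L ≤ ∑ k ∈ Finset.range (r * i), Real.log (1 / (gauss^[k] x : ℝ))} := by gcongr
    _ ≤ _ := hmk
    _ = _ := by ring

/-! ### The series -/

theorem below_zero_mul (c : ℝ) : below (((0 : ℕ) : ℝ) * c) = ∅ := by
  refine eq_empty_of_forall_notMem fun x hx => ?_
  rw [Nat.cast_zero, zero_mul] at hx
  exact absurd (coe_pos x) (not_lt.2 (le_of_lt hx))

theorem khinchineSum_eq (μ : Measure UnitIrrational) (f : ℕ → ℝ) :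
    khinchineSum μ f = ∑' n : ℕ, μ (below ((n : ℝ) * f n)) / (n : ℝ≥0∞) := by
  rw [tsum_eq_zero_add' ENNReal.summable, below_zero_mul, measure_empty, ENNReal.zero_div, zero_add]
  simp_rw [khinchineSum, setOf_mem_Ioo_eq_below]

theorem khinchineSum_term_anti (μ : Measure UnitIrrational)
    (hf_anti : AntitoneOn (fun n : ℕ => (n : ℝ) * f n) (Set.Ici 1)) ⦃m n : ℕ⦄ (hm : 0 < m)
    (hmn : m ≤ n) :
    μ (below ((n : ℝ) * f n)) / (n : ℝ≥0∞) ≤ μ (below ((m : ℝ) * f m)) / (m : ℝ≥0∞) :=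
  ENNReal.div_le_div
    (measure_mono (below_mono (hf_anti (mem_Ici.2 hm) (mem_Ici.2 (hm.trans_le hmn)) hmn)))
    (by exact_mod_cast hmn)

theorem tsum_two_pow_lt_top (μ : Measure UnitIrrational) [IsProbabilityMeasure μ]
    (hf_anti : AntitoneOn (fun n : ℕ => (n : ℝ) * f n) (Set.Ici 1))
    (h : khinchineSum μ f < ∞) :
    ∑' k : ℕ, μ (below (((2 ^ k : ℕ) : ℝ) * f (2 ^ k))) < ∞ := by
  have h1 := ENNReal.tsum_condensed_le (f := fun n : ℕ => μ (below ((n : ℝ) * f n)) / (n : ℝ≥0∞))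
    fun m n hm hmn => khinchineSum_term_anti μ hf_anti (by omega) hmn
  rw [← khinchineSum_eq] at h1
  have h2 : ∀ k : ℕ, (2 : ℝ≥0∞) ^ k *
      (μ (below (((2 ^ k : ℕ) : ℝ) * f (2 ^ k))) / ((2 ^ k : ℕ) : ℝ≥0∞)) =
      μ (below (((2 ^ k : ℕ) : ℝ) * f (2 ^ k))) := fun k => by
    rw [show ((2 ^ k : ℕ) : ℝ≥0∞) = 2 ^ k by push_cast; rfl]
    exact ENNReal.mul_div_cancel (by simp) (by finiteness)
  simp_rw [h2] at h1
  refine h1.trans_lt ?_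
  rw [show ((1 : ℕ) : ℝ≥0∞) = 1 from Nat.cast_one, div_one]
  finiteness

theorem tsum_pow_eq_top (μ : Measure UnitIrrational)
    (hf_anti : AntitoneOn (fun n : ℕ => (n : ℝ) * f n) (Set.Ici 1))
    (h : khinchineSum μ f = ∞) {L : ℕ} (hL : 2 ≤ L) :
    ∑' k : ℕ, μ (below (((L ^ k : ℕ) : ℝ) * f (L ^ k))) = ∞ := by
  have h1 := ENNReal.le_tsum_schlomilch (u := fun k => L ^ k)
    (f := fun n : ℕ => μ (below ((n : ℝ) * f n)) / (n : ℝ≥0∞))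
    (khinchineSum_term_anti μ hf_anti) (fun n => by positivity) (pow_right_strictMono₀ (by omega))
  rw [← khinchineSum_eq, h, top_le_iff] at h1
  -- The head of the Schlömilch estimate is the single index `0`, whose interval is empty.
  rw [pow_zero, Finset.sum_range_one, below_zero_mul, measure_empty, ENNReal.zero_div, zero_add] at h1
  have h2 : ∑' k : ℕ, (((L ^ (k + 1) : ℕ) : ℝ≥0∞) - ((L ^ k : ℕ) : ℝ≥0∞)) *
      (μ (below (((L ^ k : ℕ) : ℝ) * f (L ^ k))) / ((L ^ k : ℕ) : ℝ≥0∞)) ≤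
      ∑' k : ℕ, (L : ℝ≥0∞) * μ (below (((L ^ k : ℕ) : ℝ) * f (L ^ k))) := by
    refine ENNReal.tsum_le_tsum fun k => ?_
    refine (mul_le_mul_left tsub_le_self _).trans (le_of_eq ?_)
    have hne : ((L ^ k : ℕ) : ℝ≥0∞) ≠ 0 := by
      exact_mod_cast (pow_pos (by omega : 0 < L) k).ne'
    rw [pow_succ', Nat.cast_mul, mul_assoc, ENNReal.mul_div_cancel hne (ENNReal.natCast_ne_top _)]
  rw [h1, top_le_iff, ENNReal.tsum_mul_left] at h2
  by_contra hcon
  exact ENNReal.mul_ne_top (ENNReal.natCast_ne_top L) hcon h2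

/-- If large digits had measure zero, all but finitely many terms of the series would vanish. -/
theorem measure_le_partialQuotient_ne_zero {μ : Measure UnitIrrational} [IsProbabilityMeasure μ]
    (hf_lim : Tendsto (fun n : ℕ => (n : ℝ) * f n) atTop (𝓝 0))
    (h : khinchineSum μ f = ∞) (m : ℕ) : μ {x | m ≤ partialQuotient x} ≠ 0 := by
  intro hm
  obtain ⟨N, hN⟩ := eventually_atTop.1
    (hf_lim.eventually_lt_const (show (0 : ℝ) < 1 / (m + 1) by positivity))
  have hzero : ∀ n ∉ Finset.range N, μ (below ((n : ℝ) * f n)) / (n : ℝ≥0∞) = 0 := fun n hn => by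
    have hsub : below ((n : ℝ) * f n) ⊆ {x | m ≤ partialQuotient x} := fun x hx => by
      have hx1 : (x : ℝ) < 1 / (m + 1) := lt_trans hx (hN n (by simpa using hn))
      refine Nat.le_floor ?_
      rw [lt_div_iff₀ (by positivity)] at hx1
      rw [le_div_iff₀ (coe_pos x)]
      nlinarith [coe_pos x]
    rw [measure_mono_null hsub hm, ENNReal.zero_div]
  rw [khinchineSum_eq, tsum_eq_sum hzero, ENNReal.sum_eq_top] at h
  obtain ⟨n, -, hn⟩ := h
  rcases Nat.eq_zero_or_pos n with rfl | hpos
  · rw [below_zero_mul, measure_empty, ENNReal.zero_div] at hn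
    exact ENNReal.zero_ne_top hn
  · exact ENNReal.div_ne_top (measure_ne_top _ _) (by exact_mod_cast hpos.ne') hn


/-! ### The convergence part -/

theorem ae_eventually_mul_le {μ : Measure UnitIrrational} [IsProbabilityMeasure μ]
    (hG : MeasurePreserving gauss μ μ)
    (hf_anti : AntitoneOn (fun n : ℕ => (n : ℝ) * f n) (Set.Ici 1))
    (h : khinchineSum μ f < ∞) :
    ∀ᵐ x ∂μ, ∀ᶠ n in atTop, (convDen n x : ℝ) * f (convDen n x) ≤ (gauss^[n] x : ℝ) := by
  let g : ℕ → ℝ := fun k => ((2 ^ k : ℕ) : ℝ) * f (2 ^ k)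
  have hsum := (tsum_two_pow_lt_top μ hf_anti h).ne
  -- Even and odd times are treated separately, since `2^(n/2)` takes each value for two consecutive
  -- `n`.
  have hbc : ∀ b : ℕ, ∀ᵐ x ∂μ, ∀ᶠ k in atTop, x ∉ gauss^[2 * k + b] ⁻¹' below (g k) := fun b => by
    refine ae_eventually_notMem ?_
    simp_rw [fun k => (hG.iterate (2 * k + b)).measure_preimage
      (measurableSet_below (g k)).nullMeasurableSet]
    exact hsum
  filter_upwards [hbc 0, hbc 1] with x h0 h1
  obtain ⟨N, hN⟩ := eventually_atTop.1 (h0.and h1)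
  refine eventually_atTop.2 ⟨2 * N, fun n hn => ?_⟩
  have hk := hN (n / 2) (by omega)
  have hle : g (n / 2) ≤ gauss^[n] x := by
    rcases Nat.mod_two_eq_zero_or_one n with hm | hm
    · have := hk.1
      rw [show 2 * (n / 2) + 0 = n by omega] at this
      exact not_lt.1 this
    · have := hk.2
      rw [show 2 * (n / 2) + 1 = n by omega] at this
      exact not_lt.1 this
  exact (hf_anti (mem_Ici.2 Nat.one_le_two_pow) (mem_Ici.2 (convDen_pos n x))
    (two_pow_half_le_convDen n x)).trans hle

/-! ### The divergence part -/

theorem ae_frequently_of_measure_ne_zero {μ : Measure UnitIrrational} [IsProbabilityMeasure μ]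
    (hE : Ergodic gauss μ)
    (hf_anti : AntitoneOn (fun n : ℕ => (n : ℝ) * f n) (Set.Ici 1))
    (h : μ {x | ∃ᶠ n in atTop, (gauss^[n] x : ℝ) < (convDen n x : ℝ) * f (convDen n x)} ≠ 0) :
    ∀ᵐ x ∂μ, ∃ᶠ n in atTop, (gauss^[n] x : ℝ) < (convDen n x : ℝ) * f (convDen n x) := by
  set E := {x | ∃ᶠ n in atTop, (gauss^[n] x : ℝ) < (convDen n x : ℝ) * f (convDen n x)}
    with hEdef
  have hmeas : MeasurableSet E := by
    have heq : E = ⋂ M : ℕ, ⋃ n ≥ M,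
        {x | (gauss^[n] x : ℝ) < (convDen n x : ℝ) * f (convDen n x)} := by
      ext x
      simp [hEdef, frequently_atTop]
    rw [heq]
    refine MeasurableSet.iInter fun M => MeasurableSet.biUnion (to_countable _) fun n _ => ?_
    exact measurableSet_lt (measurable_subtype_coe.comp (measurable_gauss.iterate n))
      ((measurable_from_nat (f := fun d : ℕ => (d : ℝ) * f d)).comp (measurable_convDen n))
  -- Since `q_m(Gx) ≤ q_(m+1)(x)`, the target for `Gx` at time `m` contains that for `x` at time `m
  -- + 1`.
  have hsub : E ⊆ gauss ⁻¹' E := fun x hx => by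
    rw [mem_preimage, hEdef, mem_ofPred_eq, frequently_atTop]
    rw [hEdef, mem_ofPred_eq, frequently_atTop] at hx
    intro M
    obtain ⟨n, hn, hlt⟩ := hx (M + 1)
    obtain ⟨m, rfl⟩ := Nat.exists_eq_add_of_le' (Nat.one_le_of_lt hn)
    refine ⟨m, by omega, ?_⟩
    rw [← Function.iterate_succ_apply]
    exact hlt.trans_le (hf_anti (mem_Ici.2 (convDen_pos _ _)) (mem_Ici.2 (convDen_pos _ _))
      (convDen_gauss_le m x))
  rcases hE.ae_empty_or_univ_of_ae_le_preimage hmeas.nullMeasurableSet hsub.eventuallyLE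
    with h' | h'
  · exact absurd (by rw [measure_congr h', measure_empty]) h
  · exact ae_eq_univ.1 h'

theorem measureReal_inter_preimage_below_le {μ : Measure UnitIrrational} [IsProbabilityMeasure μ]
    (hG : MeasurePreserving gauss μ μ) {C : ℝ} (hC1 : 1 < C)
    (hC : ∀ n : ℕ, 1 ≤ n → ∀ A B : Set UnitIrrational,
      MeasurableSet[MeasurableSpace.generateFrom (cylinders n)] A → MeasurableSet B →
        μ.real (A ∩ gauss^[n] ⁻¹' B) ≤ C * μ.real A * μ.real B)
    {r : ℕ} (hr : 1 ≤ r) (hcyl : ∀ k x, μ.real (cyl (r * k) x) ≤ (1 / 2) ^ k)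
    {i j : ℕ} (hij : i < j) (s t : ℝ) :
    μ.real (gauss^[r * i] ⁻¹' below s ∩ gauss^[r * j] ⁻¹' below t) ≤
      C * (μ.real (below s) + (1 / 2) ^ (j - i)) * μ.real (below t) := by
  obtain ⟨k, rfl⟩ := Nat.exists_eq_add_of_lt hij
  have hk : i + k + 1 - i = k + 1 := by omega
  have hpre : gauss^[r * i] ⁻¹' below s ∩ gauss^[r * (i + k + 1)] ⁻¹' below t =
      gauss^[r * i] ⁻¹' (below s ∩ gauss^[r * (k + 1)] ⁻¹' below t) := by
    rw [preimage_inter, ← preimage_comp, ← Function.iterate_add]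
    congr 3
    ring
  rw [hk, hpre, (hG.iterate (r * i)).measureReal_preimage ((measurableSet_below s).inter
    ((measurable_gauss.iterate _) (measurableSet_below t))).nullMeasurableSet]
  -- The hull has rank equal to the time gap `r (j - i)`, as the Renyi bound requires.
  refine (measureReal_mono (inter_subset_inter_left _ (below_subset_hull (r * (k + 1)) s))).trans ?_
  refine (hC _ (Nat.mul_pos hr k.succ_pos) _ _ (measurableSet_hull _ _)
    (measurableSet_below t)).trans ?_
  have := measureReal_hull_le μ (hcyl (k + 1)) s
  gcongr

theorem sum_range_half_pow_sub_le (j : ℕ) :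
    ∑ i ∈ Finset.range j, (1 / 2 : ℝ) ^ (j - i) ≤ 1 := by
  induction j with
  | zero => simp
  | succ j ih =>
    rw [Finset.sum_range_succ]
    have : ∑ i ∈ Finset.range j, (1 / 2 : ℝ) ^ (j + 1 - i) =
        (∑ i ∈ Finset.range j, (1 / 2 : ℝ) ^ (j - i)) * (1 / 2) := by
      rw [Finset.sum_mul]
      refine Finset.sum_congr rfl fun i hi => ?_
      rw [← pow_succ, Nat.sub_add_comm (Finset.mem_range.1 hi).le]
    rw [this, Nat.add_sub_cancel_left]
    linarith

/-- The product terms give at most `C S^2`, the geometric errors at most `C S` on each side of the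
diagonal, and the diagonal at most `S`; the linear terms are absorbed because `S ≥ 1`. -/
theorem sum_sum_le_of_half_pow_mixing (s : Finset ℕ) {a : ℕ → ℝ} {b : ℕ → ℕ → ℝ} {C : ℝ}
    (hC : 0 ≤ C) (ha : ∀ i, 0 ≤ a i) (hdiag : ∀ i, b i i ≤ a i) (hsymm : ∀ i j, b i j = b j i)
    (hlt : ∀ i j, i < j → b i j ≤ C * (a i + (1 / 2) ^ (j - i)) * a j)
    (hS : 1 ≤ ∑ i ∈ s, a i) :
    ∑ i ∈ s, ∑ j ∈ s, b i j ≤ (3 * C + 1) * (∑ i ∈ s, a i) ^ 2 := by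
  let w : ℕ → ℕ → ℝ := fun i j => if i < j then (1 / 2) ^ (j - i) else 0
  have hw : ∀ j, ∑ i ∈ s, w i j ≤ 1 := fun j => by
    refine le_trans ?_ (sum_range_half_pow_sub_le j)
    rw [← Finset.sum_filter]
    exact Finset.sum_le_sum_of_subset_of_nonneg
      (fun i hi => Finset.mem_range.2 (Finset.mem_filter.1 hi).2) fun _ _ _ => by positivity
  have hb : ∀ i j, b i j ≤ C * (a i * a j) + C * (w i j * a j) + C * (w j i * a i) +
      if i = j then a j else 0 := fun i j => by
    have hp : 0 ≤ C * (a i * a j) := mul_nonneg hC (mul_nonneg (ha i) (ha j))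
    rcases lt_trichotomy i j with h | rfl | h
    · simp only [w, h, h.ne, not_lt.2 h.le, if_true, if_false]
      linarith [hlt i j h]
    · simp only [w, lt_irrefl, if_true, if_false]
      linarith [hdiag i]
    · simp only [w, h, h.ne', not_lt.2 h.le, if_true, if_false]
      rw [hsymm]
      linarith [hlt j i h]
  set S := ∑ i ∈ s, a i with hSdef
  have hcol : ∑ j ∈ s, ∑ i ∈ s, w i j * a j ≤ S := by
    refine Finset.sum_le_sum fun j _ => ?_
    rw [← Finset.sum_mul]
    exact mul_le_of_le_one_left (ha j) (hw j)
  calc ∑ i ∈ s, ∑ j ∈ s, b i j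
      ≤ ∑ i ∈ s, ∑ j ∈ s, (C * (a i * a j) + C * (w i j * a j) + C * (w j i * a i) +
        if i = j then a j else 0) :=
        Finset.sum_le_sum fun i _ => Finset.sum_le_sum fun j _ => hb i j
    _ = C * S ^ 2 + C * (∑ j ∈ s, ∑ i ∈ s, w i j * a j) +
        C * (∑ j ∈ s, ∑ i ∈ s, w i j * a j) + S := by
      simp only [Finset.sum_add_distrib, ← Finset.mul_sum]
      rw [← Finset.sum_mul, ← hSdef, Finset.sum_comm (f := fun i j => w i j * a j)]
      have : ∑ i ∈ s, ∑ j ∈ s, (if i = j then a j else 0) = S :=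
        Finset.sum_congr rfl fun i hi => by rw [Finset.sum_ite_eq, if_pos hi]
      rw [this, sq]
    _ ≤ C * S ^ 2 + C * S + C * S + S := by gcongr
    _ ≤ (3 * C + 1) * S ^ 2 := by nlinarith [mul_nonneg hC (sub_nonneg.2 hS)]

theorem exists_le_measureReal_inter {μ : Measure UnitIrrational} [IsProbabilityMeasure μ]
    (hG : MeasurePreserving gauss μ μ) (h : expLog μ < ∞) {C : ℝ} (hC1 : 1 < C)
    (hC : ∀ n : ℕ, 1 ≤ n → ∀ A B : Set UnitIrrational,
      MeasurableSet[MeasurableSpace.generateFrom (cylinders n)] A → MeasurableSet B →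
        μ.real (A ∩ gauss^[n] ⁻¹' B) ≤ C * μ.real A * μ.real B)
    {r : ℕ} (hr : 1 ≤ r) :
    ∃ L : ℕ, 2 ≤ L ∧ ∀ i : ℕ, 1 ≤ i → ∀ t : ℝ, μ.real (below t) / 2 ≤
      μ.real (gauss^[r * i] ⁻¹' below t ∩ {x | convDen (r * i) x ≤ L ^ i}) := by
  set I := ∫ x : UnitIrrational, Real.log (1 / (x : ℝ)) ∂μ
  have hlim : Tendsto (fun L : ℕ => r * I / Real.log L) atTop (𝓝 0) :=
    (Real.tendsto_log_atTop.comp tendsto_natCast_atTop_atTop).const_div_atTop _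
  obtain ⟨L, hL, hL2⟩ := ((hlim.eventually_lt_const
    (show (0 : ℝ) < 1 / (2 * C) by positivity)).and (eventually_ge_atTop 2)).exists
  refine ⟨L, hL2, fun i hi t => ?_⟩
  have hbad := hC (r * i) (Nat.mul_pos hr hi) _ _
    (measurableSet_lt_convDen (r * i) (L ^ i)) (measurableSet_below t)
  have hpre : μ.real (gauss^[r * i] ⁻¹' below t) = μ.real (below t) :=
    (hG.iterate (r * i)).measureReal_preimage (measurableSet_below t).nullMeasurableSet
  have hhalf : C * μ.real {x | L ^ i < convDen (r * i) x} ≤ 1 / 2 := by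
    have := (measureReal_pow_lt_convDen_le hG h hL2 r hi).trans hL.le
    rw [le_div_iff₀ (by positivity)] at this
    linarith
  have hcover : gauss^[r * i] ⁻¹' below t ⊆
      (gauss^[r * i] ⁻¹' below t ∩ {x | convDen (r * i) x ≤ L ^ i}) ∪
        ({x | L ^ i < convDen (r * i) x} ∩ gauss^[r * i] ⁻¹' below t) := fun x hx =>
    (le_or_gt (convDen (r * i) x) (L ^ i)).imp (fun h => ⟨hx, h⟩) fun h => ⟨h, hx⟩
  have hle := (measureReal_mono (μ := μ) hcover).trans (measureReal_union_le _ _)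
  rw [hpre] at hle
  have := mul_le_mul_of_nonneg_right hhalf (measureReal_nonneg (μ := μ) (s := below t))
  linarith

theorem measure_frequently_lt_ne_zero {μ : Measure UnitIrrational} [IsProbabilityMeasure μ]
    (hμ : IsWeakRenyi μ)
    (hf_anti : AntitoneOn (fun n : ℕ => (n : ℝ) * f n) (Set.Ici 1))
    (hf_lim : Tendsto (fun n : ℕ => (n : ℝ) * f n) atTop (𝓝 0))
    (hE : Ergodic gauss μ) (hlog : expLog μ < ∞) (hsum : khinchineSum μ f = ∞) :
    μ {x | ∃ᶠ n in atTop, (gauss^[n] x : ℝ) < (convDen n x : ℝ) * f (convDen n x)} ≠ 0 := by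
  obtain ⟨C, hC1, hC⟩ := hμ.exists_measureReal_le
  obtain ⟨r, hr, hcyl⟩ := exists_measureReal_cyl_le_pow hE
    (measure_le_partialQuotient_ne_zero hf_lim hsum) hC1 hC
  obtain ⟨L, hL, hgood⟩ := exists_le_measureReal_inter hμ.invariant hlog hC1 hC hr
  let t : ℕ → ℝ := fun i => ((L ^ i : ℕ) : ℝ) * f (L ^ i)
  let a : ℕ → ℝ := fun i => μ.real (below (t i))
  let F : ℕ → Set UnitIrrational := fun i =>
    gauss^[r * i] ⁻¹' below (t i) ∩ {x | convDen (r * i) x ≤ L ^ i}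
  have hpre : ∀ i, MeasurableSet (gauss^[r * i] ⁻¹' below (t i)) := fun i =>
    (measurable_gauss.iterate _) (measurableSet_below _)
  have hF : ∀ i, MeasurableSet (F i) := fun i =>
    (hpre i).inter (measurable_convDen _ measurableSet_Iic)
  have hnot : ¬ Summable a := fun hs => by
    refine hs.tsum_ofReal_ne_top ?_
    simp_rw [a, ofReal_measureReal (measure_ne_top μ _)]
    exact tsum_pow_eq_top μ hf_anti hsum hL
  -- Starting at `M + 1` keeps the indices positive, as `hgood` requires.
  have hlarge : ∀ M : ℕ, ∃ s : Finset ℕ, (∀ i ∈ s, M + 1 ≤ i) ∧ 1 ≤ ∑ i ∈ s, a i := fun M => by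
    have hnot' : ¬ Summable fun i => a (i + (M + 1)) := fun hs =>
      hnot ((summable_nat_add_iff (M + 1)).1 hs)
    have ht := (not_summable_iff_tendsto_nat_atTop_of_nonneg fun i => measureReal_nonneg).1 hnot'
    obtain ⟨N, hN⟩ := (ht.eventually_ge_atTop 1).exists
    refine ⟨(Finset.range N).map (addRightEmbedding (M + 1)), ?_, ?_⟩
    · simp
      omega
    · rw [Finset.sum_map]
      exact hN
  have hpos : 0 < μ {x | ∃ᶠ i in atTop, x ∈ F i} := by
    -- The factor `4` pays for `∑ μ(F i)` being only at least half of `∑ a i`, once squared.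
    refine measure_frequently_pos μ hF (K := 4 * (3 * C + 1)) (by positivity) fun M => ?_
    obtain ⟨s, hs, hS⟩ := hlarge M
    have hhalf : (∑ i ∈ s, a i) / 2 ≤ ∑ i ∈ s, μ.real (F i) := by
      rw [Finset.sum_div]
      exact Finset.sum_le_sum fun i hi => hgood i (by have := hs i hi; omega) (t i)
    refine ⟨s, fun i hi => by have := hs i hi; omega, by linarith, ?_⟩
    have hle : ∀ i j, μ.real (F i ∩ F j) ≤
        μ.real (gauss^[r * i] ⁻¹' below (t i) ∩ gauss^[r * j] ⁻¹' below (t j)) := fun i j =>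
      measureReal_mono (inter_subset_inter inter_subset_left inter_subset_left)
    refine (Finset.sum_le_sum fun i _ => Finset.sum_le_sum fun j _ => hle i j).trans ?_
    refine (sum_sum_le_of_half_pow_mixing s (a := a) (by positivity) (fun _ => measureReal_nonneg)
      (fun i => ?_) (fun i j => by rw [inter_comm]) (fun i j hij =>
        measureReal_inter_preimage_below_le hμ.invariant hC1 hC hr hcyl hij _ _) hS).trans ?_
    · rw [inter_self]
      exact ((hμ.invariant.iterate _).measureReal_preimage
        (measurableSet_below _).nullMeasurableSet).le
    · rw [mul_comm 4, mul_assoc]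
      refine mul_le_mul_of_nonneg_left ?_ (by positivity)
      nlinarith
  refine (hpos.trans_le (measure_mono fun x hx => ?_)).ne'
  rw [mem_ofPred_eq, frequently_atTop] at hx ⊢
  intro M
  obtain ⟨i, hi, hlt, hden⟩ := hx M
  refine ⟨r * i, hi.trans (Nat.le_mul_of_pos_left i hr), ?_⟩
  exact lt_of_lt_of_le hlt (hf_anti (mem_Ici.2 (convDen_pos _ _))
    (mem_Ici.2 (Nat.one_le_pow _ _ (by omega))) hden)

end GaussMap

theorem theorem3p2
    (μ : Measure GaussMap.UnitIrrational) [IsProbabilityMeasure μ]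
    (hμ : GaussMap.IsWeakRenyi μ)
    (f : ℕ → ℝ) (hf_nonneg : ∀ n : ℕ, 1 ≤ n → 0 ≤ f n)
    (hf_anti : AntitoneOn (fun n : ℕ => (n : ℝ) * f n) (Set.Ici 1))
    (hf_lim : Tendsto (fun n : ℕ => (n : ℝ) * f n) atTop (𝓝 0)) :
    (GaussMap.khinchineSum μ f < ∞ →
      ∀ᵐ x : GaussMap.UnitIrrational ∂μ,
        (GaussMap.solutions (x : ℝ)
          (fun q => f q / ((2 * Real.exp 8) * (q : ℝ)))).Finite) ∧
    (Ergodic GaussMap.gauss μ → GaussMap.expLog μ < ∞ → GaussMap.khinchineSum μ f = ∞ →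
      ∀ᵐ x : GaussMap.UnitIrrational ∂μ,
        (GaussMap.solutions (x : ℝ) (fun q => f q / (q : ℝ))).Infinite) := by
  refine ⟨fun hsum => ?_, fun hE hlog hsum => ?_⟩
  · filter_upwards [GaussMap.ae_eventually_mul_le hμ.invariant hf_anti hsum] with x hx
    refine GaussMap.finite_solutions_of_eventually hf_nonneg hf_anti hf_lim ?_ x hx
    -- Any constant at least `2` suffices in the convergence part; of `e^8` only `e^8 ≥ 1` is used.
    have : (1 : ℝ) ≤ Real.exp 8 := Real.one_le_exp (by norm_num)
    linarith
  · filter_upwards [GaussMap.ae_frequently_of_measure_ne_zero hE hf_anti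
      (GaussMap.measure_frequently_lt_ne_zero hμ hf_anti hf_lim hE hlog hsum)] with x hx
    exact GaussMap.infinite_solutions_of_frequently x hx
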